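/- All graphs are finite, undirected and simple. A leaf of a tree is a vertex of degree at most $1$. For positive integers $h,s,t$, a graph $G$ belongs to the class $\mathrm{ORTH}[h,s,t]$ if there are a tree $T$ of maximum degree at most $h$ and, for every vertex $u$ of $G$, a subtree $S_u$ of $T$ of maximum degree at most $s$, such that for every $u$ all leaves of $S_u$ are also leaves of $T$, and for every two distinct vertices $u,v$ of $G$ the following are equivalent: (i) $u$ and $v$ are adjacent; (ii) $S_u$ and $S_v$ have at least $t$ vertices in common; (iii) $S_u$ and $S_v$ share a leaf of $T$. Let $L(K_n)$ denote the line graph of the complete graph $K_n$ on $n$ vertices. Let $h$ and $t$ be integers with $h\ge 3$ and $t\ge 3$. If $t$ is odd, then $$\{n\in\mathbb N : L(K_n)\in \mathrm{ORTH}[h+1,2,t]\setminus \mathrm{ORTH}[h,2,t]\}=\{n\in\mathbb N: 2(h-1)^{(t-1)/2}+1\le n\le 2h^{(t-1)/2}\},$$ and if $t$ is even, then $$\{n\in\mathbb N : L(K_n)\in \mathrm{ORTH}[h+1,2,t]\setminus \mathrm{ORTH}[h,2,t]\}=\{n\in\mathbb N: h(h-1)^{t/2-1}+1\le n\le (h+1)h^{t/2-1}\}.$$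 In particular, for all such $h$ and $t$ there is an $n$ with $L(K_n)\in \mathrm{ORTH}[h+1,2,t]\setminus \mathrm{ORTH}[h,2,t]$. -/

import Mathlib

/-- A leaf of a graph: a vertex of degree at most `1`. -/
def IsLeaf {W : Type*} (T : SimpleGraph W) (x : W) : Prop :=
  (T.neighborSet x).ncard ≤ 1

/-- A leaf of a subgraph `S`: a vertex of `S` whose degree in `S` is at most `1`. -/
def IsLeafOf {W : Type*} {T : SimpleGraph W} (S : T.Subgraph) (x : W) : Prop :=
  x ∈ S.verts ∧ (S.neighborSet x).ncard ≤ 1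

/-- `(T, S)` is an `(h, s, t)`-representation of `G` (for a finite host graph `T`): `T` is a tree
of maximum degree at most `h`, every `S u` is a subtree of `T` of maximum degree at most `s`, and
distinct vertices `u`, `v` of `G` are adjacent if and only if `S u` and `S v` have at least `t`
vertices in common. -/
structure IsRepresentation {V W : Type*} (h s t : ℕ) (G : SimpleGraph V) (T : SimpleGraph W)
    (S : V → T.Subgraph) : Prop where
  isTree : T.IsTree
  degree_le : ∀ x : W, (T.neighborSet x).ncard ≤ h
  subtree_isTree : ∀ u : V, (S u).coe.IsTree
  subtree_degree_le : ∀ u : V, ∀ x ∈ (S u).verts, ((S u).neighborSet x).ncard ≤ s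
  adj_iff_card : ∀ u v : V, u ≠ v →
    (G.Adj u v ↔ t ≤ ((S u).verts ∩ (S v).verts).ncard)

/-- An `(h, s, t)`-representation is orthodox if all leaves of every `S u` are leaves of `T`, and
distinct vertices `u`, `v` of `G` are adjacent if and only if `S u` and `S v` share a leaf
of `T`. -/
structure IsOrthodoxRepresentation {V W : Type*} (h s t : ℕ) (G : SimpleGraph V)
    (T : SimpleGraph W) (S : V → T.Subgraph) : Prop extends IsRepresentation h s t G T S where
  leaf_of_subtree : ∀ u : V, ∀ x : W, IsLeafOf (S u) x → IsLeaf T x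
  adj_iff_leaf : ∀ u v : V, u ≠ v →
    (G.Adj u v ↔ ∃ x : W, IsLeaf T x ∧ x ∈ (S u).verts ∧ x ∈ (S v).verts)

/-- Membership of `G` in the class `ORTH[h, s, t]`: there is an orthodox
`(h, s, t)`-representation of `G` in a finite tree. -/
def InORTH {V : Type*} (h s t : ℕ) (G : SimpleGraph V) : Prop :=
  ∃ (W : Type) (_ : Finite W) (T : SimpleGraph W) (S : V → T.Subgraph),
    IsOrthodoxRepresentation h s t G T S

/-! Everything follows from one threshold: for `2 ≤ q` and `3 ≤ t`, L(K_n) lies in ORTH[q+1,2,t]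
exactly if `n ≤ maxOrthOrder q t`. It is applied with q = h - 1 and q = h; strict growth in q gives
the last claim.

Upper bound. A subtree of maximum degree at most 2 is a path, so every edge ij of K_n carries at
most two leaves of T. For n ≥ 5, `exists_injective_mem_of_inter_iff` turns this into distinct marked
leaves l_i such that the path of ij contains l_i and l_j. Call an oriented edge of T heavy if at
least two marked leaves lie beyond it. If two heavy edges point away from each other, then two
disjoint edges of K_n have paths which both contain the stretch between them, so this stretch has
fewer than t vertices. Hence all heavy edges are close to a centre. Beyond them each branch has at
most one marked leaf, and counting branches gives `card_le_of_heavy_close`. The case n ≤ 4 lies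
below the threshold anyway.

Lower bound. Hang q-ary trees of depth K on an edge (t odd) or on the q + 1 outer vertices of a star
(t even), and prolong each of their ends by a tail so that t vertices are private to each leaf.
Paths with a common end share these t vertices; paths with four distinct ends share at most 2K
vertices, plus the centre of the star when t is even. -/

namespace SimpleGraph

/-! ### Distances in trees -/

section TreeMetric

variable {W : Type*} {T : SimpleGraph W}

theorem IsTree.eq_of_adj_of_dist_add_one (hT : T.IsTree) {u v w x : W} (hu : T.Adj v u)
    (hw : T.Adj v w) (hux : T.dist v x = T.dist u x + 1) (hwx : T.dist v x = T.dist w x + 1) :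
    u = w := by
  obtain ⟨p, hp⟩ := hT.connected.exists_walk_length_eq_dist u x
  obtain ⟨p', hp'⟩ := hT.connected.exists_walk_length_eq_dist w x
  have h1 : (Walk.cons hu p).IsPath :=
    Walk.isPath_of_length_eq_dist _ (by rw [Walk.length_cons, hp, hux])
  have h2 : (Walk.cons hw p').IsPath :=
    Walk.isPath_of_length_eq_dist _ (by rw [Walk.length_cons, hp', hwx])
  have := (hT.isAcyclic.subsingleton_path v x).elim ⟨_, h1⟩ ⟨_, h2⟩
  have := congrArg (fun P : T.Path v x => P.1.snd) this
  simpa using this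

theorem Connected.exists_adj_dist_add_one (hT : T.Connected) {v x : W} (h : v ≠ x) :
    ∃ w, T.Adj v w ∧ T.dist v x = T.dist w x + 1 := by
  obtain ⟨p, hp⟩ := hT.exists_walk_length_eq_dist v x
  cases p with
  | nil => exact absurd rfl h
  | @cons _ w _ hvw p =>
    refine ⟨w, hvw, ?_⟩
    have h1 := T.dist_le p
    have h2 := hT.dist_triangle (u := v) (v := w) (w := x)
    rw [dist_eq_one_iff_adj.2 hvw] at h2
    rw [Walk.length_cons] at hp
    omega

theorem IsTree.dist_cases (hT : T.IsTree) {u v : W} (h : T.Adj u v) (x : W) :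
    T.dist u x = T.dist v x + 1 ∨ T.dist v x = T.dist u x + 1 := by
  have := hT.dist_eq_dist_add_one_of_adj x h
  rw [T.dist_comm (u := x), T.dist_comm (u := x)] at this
  exact this

/-- Other neighbours of `v` are further from anything that lies behind `u`. -/
theorem IsTree.dist_eq_add_one_of_ne (hT : T.IsTree) {u v w x : W} (hu : T.Adj v u)
    (hw : T.Adj v w) (hne : u ≠ w) (hux : T.dist v x = T.dist u x + 1) :
    T.dist w x = T.dist v x + 1 :=
  (hT.dist_cases hw x).resolve_left fun h => hne (hT.eq_of_adj_of_dist_add_one hu hw hux h)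

/-- Distances add up across an edge which separates the two vertices. -/
theorem IsTree.dist_eq_of_separates (hT : T.IsTree) {u v x y : W} (h : T.Adj u v)
    (hx : T.dist u x = T.dist v x + 1) (hy : T.dist v y = T.dist u y + 1) :
    T.dist x y = T.dist v x + T.dist v y := by
  induction hm : T.dist v x generalizing u v with
  | zero =>
    rw [hT.connected.dist_eq_zero_iff] at hm
    subst hm
    simp
  | succ m ih =>
    have hvx : v ≠ x := by
      rintro rfl
      simp at hm
    obtain ⟨w, hvw, hw⟩ := hT.connected.exists_adj_dist_add_one hvx
    have huw : u ≠ w := by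
      rintro rfl
      omega
    have := hT.dist_eq_add_one_of_ne h.symm hvw huw hy
    have := ih hvw hw this (by omega)
    omega

/-- Two geodesics through `y` concatenate to the unique path from `a` to `c`, and every walk between
these ends contains that path. -/
theorem IsTree.mem_support_of_dist_add_dist (hT : T.IsTree) {a c y : W}
    (h : T.dist a y + T.dist y c = T.dist a c) (p : T.Walk a c) : y ∈ p.support := by
  classical
  obtain ⟨p₁, h₁⟩ := hT.connected.exists_walk_length_eq_dist a y
  obtain ⟨p₂, h₂⟩ := hT.connected.exists_walk_length_eq_dist y c
  have hp : (p₁.append p₂).IsPath :=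
    Walk.isPath_of_length_eq_dist _ (by rw [Walk.length_append, h₁, h₂, h])
  have := (hT.isAcyclic.subsingleton_path a c).elim ⟨_, hp⟩ ⟨_, p.bypass_isPath⟩
  apply p.support_bypass_subset_support
  rw [show p.bypass = p₁.append p₂ from (congrArg (fun P : T.Path a c => P.1) this).symm]
  simp

end TreeMetric

/-! ### Counting marked leaves through heavy edges -/

section MarkedLeaves

variable {W ι : Type*} [Fintype ι] (T : SimpleGraph W) (l : ι → W)

/-- The indices of the marked vertices which lie beyond `v`, seen from `u`. -/
noncomputable def farSide (u v : W) : Finset ι :=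
  {i | T.dist u (l i) = T.dist v (l i) + 1}

/-- At least two marked vertices lie beyond `v`, seen from the adjacent vertex `u`. -/
def IsHeavy (u v : W) : Prop :=
  T.Adj u v ∧ 2 ≤ (T.farSide l u v).card

variable {T l}

theorem mem_farSide {u v : W} {i : ι} :
    i ∈ T.farSide l u v ↔ T.dist u (l i) = T.dist v (l i) + 1 := by
  simp [farSide]

/-- `r` bounds the number of branching levels beyond `v`. For `r = 0` the edge itself is not heavy,
so at most one marked leaf lies beyond it. Otherwise `v` is itself a marked leaf, with nothing
behind it, or the count splits over its at most `q` other neighbours. -/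
theorem IsTree.card_farSide_le [Finite W] (hT : T.IsTree) {q : ℕ} (hq : 1 ≤ q)
    (hdeg : ∀ x, (T.neighborSet x).ncard ≤ q + 1) (hl : Function.Injective l)
    (hleaf : ∀ i, IsLeaf T (l i)) (r : ℕ) {u v : W} (huv : T.Adj u v)
    (hr : ∀ u' v', T.IsHeavy l u' v' → T.dist u v' = T.dist u u' + 1 →
      T.dist u v' = T.dist v v' + 1 → T.dist v v' < r) :
    (T.farSide l u v).card ≤ q ^ r := by
  classical
  induction r generalizing u v with
  | zero =>
    by_contra hcon
    have := hr u v ⟨huv, by rw [pow_zero] at hcon; omega⟩ (by simp [dist_eq_one_iff_adj.2 huv])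
      (by simp [dist_eq_one_iff_adj.2 huv])
    omega
  | succ r ih =>
    have hnb : ∀ i ∈ T.farSide l u v, v ≠ l i → ∃ w ∈ T.neighborSet v \ {u},
        i ∈ T.farSide l v w := by
      intro i hi hvi
      rw [mem_farSide] at hi
      obtain ⟨w, hw, hwd⟩ := hT.connected.exists_adj_dist_add_one hvi
      refine ⟨w, ⟨hw, ?_⟩, mem_farSide.2 hwd⟩
      rintro rfl
      omega
    by_cases hv : ∃ i, l i = v
    · obtain ⟨i, hi⟩ := hv
      have : T.farSide l u v ⊆ {i} := by
        intro j hj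
        rw [Finset.mem_singleton]
        apply hl
        rw [hi]
        by_contra hjv
        obtain ⟨w, ⟨hw, hwu⟩, -⟩ := hnb j hj (Ne.symm hjv)
        have h1 := hleaf i
        rw [IsLeaf, hi, Set.ncard_le_one (Set.toFinite _)] at h1
        exact hwu (h1 w hw u huv.symm)
      calc _ ≤ _ := Finset.card_le_card this
        _ ≤ _ := by simpa using Nat.one_le_pow _ _ hq
    · have hfin : (T.neighborSet v \ {u}).Finite := Set.toFinite _
      have hcard : hfin.toFinset.card ≤ q := by
        rw [← Set.ncard_eq_toFinset_card _ hfin, Set.ncard_sdiff_singleton_of_mem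
          (show u ∈ T.neighborSet v from huv.symm)]
        have := hdeg v
        omega
      have hsub : T.farSide l u v ⊆ hfin.toFinset.biUnion (fun w => T.farSide l v w) := by
        intro i hi
        rw [Finset.mem_biUnion]
        obtain ⟨w, hw, hi'⟩ := hnb i hi (fun h => hv ⟨i, h.symm⟩)
        exact ⟨w, by simpa using hw, hi'⟩
      calc _ ≤ _ := Finset.card_le_card hsub
        _ ≤ hfin.toFinset.card * q ^ r := by
          refine Finset.card_biUnion_le_card_mul _ _ _ ?_
          intro w hw
          rw [Set.Finite.mem_toFinset] at hw
          obtain ⟨hvw, hwu⟩ := hw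
          refine ih hvw ?_
          intro u' v' hh h1 h2
          have h3 : T.dist u v' = T.dist v v' + 1 :=
            hT.dist_eq_add_one_of_ne hvw huv.symm hwu h2
          have h4 := hT.connected.dist_triangle (u := u) (v := v) (w := u')
          have h5 := hT.connected.dist_triangle (u := u) (v := u') (w := v')
          rw [dist_eq_one_iff_adj.2 huv] at h4
          rw [dist_eq_one_iff_adj.2 hh.1] at h5
          have := hr u' v' hh (by omega) h3
          omega
        _ ≤ q * q ^ r := Nat.mul_le_mul_right _ hcard
        _ = q ^ (r + 1) := by ring

theorem IsTree.card_le_of_dist_heavy_le [Finite W] (hT : T.IsTree) {q : ℕ} (hq : 1 ≤ q)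
    (hdeg : ∀ x, (T.neighborSet x).ncard ≤ q + 1) (hl : Function.Injective l)
    (hleaf : ∀ i, IsLeaf T (l i)) (r : ℕ) (c : W)
    (hr : ∀ u v, T.IsHeavy l u v → T.dist c v = T.dist c u + 1 → T.dist c v ≤ r) :
    Fintype.card ι ≤ (q + 1) * q ^ r := by
  classical
  have hfin : (T.neighborSet c).Finite := Set.toFinite _
  have hfar : ∀ w ∈ hfin.toFinset, (T.farSide l c w).card ≤ q ^ r := by
    intro w hw
    rw [Set.Finite.mem_toFinset] at hw
    refine hT.card_farSide_le hq hdeg hl hleaf r hw ?_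
    intro u v huv h1 h2
    have := hr u v huv h1
    omega
  have hcov : ∀ i, l i ≠ c → i ∈ hfin.toFinset.biUnion (fun w => T.farSide l c w) := by
    intro i hi
    obtain ⟨w, hw, hwd⟩ := hT.connected.exists_adj_dist_add_one (Ne.symm hi)
    rw [Finset.mem_biUnion]
    exact ⟨w, by simpa using hw, mem_farSide.2 hwd⟩
  have hU := Finset.card_biUnion_le_card_mul _ _ _ hfar
  have hcard : hfin.toFinset.card = (T.neighborSet c).ncard :=
    (Set.ncard_eq_toFinset_card _ hfin).symm
  have hpow : 1 ≤ q ^ r := Nat.one_le_pow _ _ hq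
  by_cases hc : ∃ i, l i = c
  · obtain ⟨i, hi⟩ := hc
    have : (Finset.univ : Finset ι) ⊆ insert i (hfin.toFinset.biUnion (T.farSide l c)) := by
      intro j _
      rw [Finset.mem_insert]
      by_cases hj : l j = c
      · left
        exact hl (hj.trans hi.symm)
      · exact Or.inr (hcov j hj)
    have h1 := (Finset.card_le_card this).trans (Finset.card_insert_le _ _)
    have h2 := hleaf i
    rw [IsLeaf, hi, ← hcard] at h2
    have h3 := Nat.mul_le_mul_right (q ^ r) h2
    rw [Finset.card_univ] at h1
    nlinarith
  · have : (Finset.univ : Finset ι) ⊆ hfin.toFinset.biUnion (T.farSide l c) :=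
      fun j _ => hcov j (fun hj => hc ⟨j, hj⟩)
    have h1 := Finset.card_le_card this
    rw [Finset.card_univ] at h1
    exact h1.trans (hU.trans (Nat.mul_le_mul_right _ (hcard ▸ hdeg c)))

/-- The bound on the number of marked leaves if any two heavy edges pointing away from each other
are close. -/
theorem IsTree.card_le_of_heavy_close [Finite W] (hT : T.IsTree) {q t : ℕ} (hq : 2 ≤ q)
    (ht : 3 ≤ t) (hdeg : ∀ x, (T.neighborSet x).ncard ≤ q + 1) (hl : Function.Injective l)
    (hleaf : ∀ i, IsLeaf T (l i))
    (hclose : ∀ u v u' v', T.IsHeavy l u v → T.IsHeavy l u' v' →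
      T.dist v v' = T.dist u v' + 1 → T.dist v v' = T.dist v u' + 1 → T.dist v v' + 2 ≤ t) :
    (Odd t → Fintype.card ι ≤ 2 * q ^ ((t - 1) / 2)) ∧
      (Even t → Fintype.card ι ≤ (q + 1) * q ^ (t / 2 - 1)) := by
  classical
  -- The closeness hypothesis for heavy edges on opposite sides of the edge from `c` to `c₁`, with
  -- distances measured from `c₁`.
  have hclose' : ∀ c c₁ u v u₁ v₁, T.Adj c c₁ → T.IsHeavy l u v → T.IsHeavy l u₁ v₁ →
      T.dist c v = T.dist c u + 1 → T.dist c v = T.dist c₁ v + 1 →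
      T.dist c₁ v₁ = T.dist c₁ u₁ + 1 → T.dist c₁ v₁ = T.dist c v₁ + 1 →
      T.dist c₁ v₁ + T.dist c₁ v + 2 ≤ t := by
    intro c c₁ u v u₁ v₁ hcc huv huv₁ h1 h2 h3 h4
    have h5 := hT.dist_eq_of_separates hcc h2 h4
    have h6 := hT.connected.dist_triangle (u := v) (v := c₁) (w := u₁)
    have h7 := hT.connected.dist_triangle (u := u) (v := c) (w := v₁)
    have h8 := hT.connected.dist_triangle (u := v) (v := u) (w := v₁)
    have h9 := hT.connected.dist_triangle (u := v) (v := u₁) (w := v₁)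
    rw [dist_eq_one_iff_adj.2 huv.1.symm] at h8
    rw [dist_eq_one_iff_adj.2 huv₁.1] at h9
    have e1 := T.dist_comm (u := v) (v := c₁)
    have e2 := T.dist_comm (u := u) (v := c)
    have := hclose u v u₁ v₁ huv huv₁ (by omega) (by omega)
    omega
  have hne : Nonempty W := hT.connected.nonempty
  -- The least `r` for which some `c` satisfies `P r c` is a radius, and such a `c` a centre, of the
  -- set of heavy edges.
  let P : ℕ → W → Prop := fun r c =>
    ∀ u v, T.IsHeavy l u v → T.dist c v = T.dist c u + 1 → T.dist c v ≤ r
  have hex : ∃ r, ∃ c, P r c := by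
    obtain ⟨c⟩ := hne
    obtain ⟨r, hr⟩ := (Set.finite_range (fun v => T.dist c v)).bddAbove
    exact ⟨r, c, fun u v _ _ => hr ⟨v, rfl⟩⟩
  obtain ⟨c, hc⟩ := Nat.find_spec hex
  have hmin := fun m (hm : m < Nat.find hex) => Nat.find_min hex hm
  generalize Nat.find hex = r at hc hmin
  -- a furthest heavy edge, and the neighbour of the centre towards it
  have hkey : 1 ≤ r → ∃ c₁ u v, T.Adj c c₁ ∧ T.IsHeavy l u v ∧ T.dist c v = T.dist c u + 1 ∧
      T.dist c v = T.dist c₁ v + 1 ∧ T.dist c v = r := by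
    intro hr
    have h1 := hmin (r - 1) (by omega)
    push Not at h1
    have h2 := h1 c
    simp only [P] at h2
    push Not at h2
    obtain ⟨u, v, huv, h3, h4⟩ := h2
    have hcv : c ≠ v := by
      rintro rfl
      simp at h3
    obtain ⟨c₁, hcc, hd⟩ := hT.connected.exists_adj_dist_add_one hcv
    have := hc u v huv h3
    exact ⟨c₁, u, v, hcc, huv, h3, hd, by omega⟩
  -- Since `c₁` does no better than `c`, some heavy edge pointing away from `c₁` has its head at
  -- distance at least `r` from `c₁`. It must lie on the side of `c`, since otherwise its distance
  -- from `c` would exceed `r`. Together with the furthest edge behind `c₁` it gives the bound.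
  have hrt : 2 * r + 1 ≤ t := by
    rcases Nat.eq_zero_or_pos r with rfl | hr
    · omega
    obtain ⟨c₁, u, v, hcc, huv, h1, h2, h3⟩ := hkey hr
    have h4 := hmin (r - 1) (by omega)
    push Not at h4
    have h5 := h4 c₁
    simp only [P] at h5
    push Not at h5
    obtain ⟨u₁, v₁, huv₁, h6, h7⟩ := h5
    have h8 : T.dist c₁ v₁ = T.dist c v₁ + 1 := by
      refine (hT.dist_cases hcc v₁).resolve_left fun h => ?_
      have h9 := hT.connected.dist_triangle (u := c) (v := c₁) (w := u₁)
      have h10 := hT.connected.dist_triangle (u := c) (v := u₁) (w := v₁)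
      rw [dist_eq_one_iff_adj.2 hcc] at h9
      rw [dist_eq_one_iff_adj.2 huv₁.1] at h10
      have := hc u₁ v₁ huv₁ (by omega)
      omega
    have := hclose' c c₁ u v u₁ v₁ hcc huv huv₁ h1 h2 h6 h8
    omega
  have hq1 : 1 ≤ q := by omega
  constructor
  · rintro ⟨k, rfl⟩
    have ek : (2 * k + 1 - 1) / 2 = k := by omega
    rw [ek]
    -- In the extremal case the true centre is the edge from `c` to `c₁`, each side of which has at
    -- most `q ^ r` marked leaves. For smaller `r` the count around a vertex suffices, as `q + 1 ≤ 2
    -- * q`.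
    by_cases hrk : r = k
    · subst hrk
      obtain ⟨c₁, u, v, hcc, huv, h1, h2, h3⟩ := hkey (by omega)
      have hA : (T.farSide l c c₁).card ≤ q ^ r := by
        refine hT.card_farSide_le hq1 hdeg hl hleaf r hcc ?_
        intro u' v' hh h4 h5
        have := hc u' v' hh h4
        omega
      have hB : (T.farSide l c₁ c).card ≤ q ^ r := by
        refine hT.card_farSide_le hq1 hdeg hl hleaf r hcc.symm ?_
        intro u₁ v₁ hh h4 h5
        have := hclose' c c₁ u v u₁ v₁ hcc huv hh h1 h2 h4 h5
        omega
      have : (Finset.univ : Finset ι) ⊆ T.farSide l c c₁ ∪ T.farSide l c₁ c := by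
        intro i _
        rw [Finset.mem_union, mem_farSide, mem_farSide]
        exact hT.dist_cases hcc _
      have := (Finset.card_le_card this).trans (Finset.card_union_le _ _)
      rw [Finset.card_univ] at this
      omega
    · obtain ⟨k, rfl⟩ : ∃ k', k = k' + 1 := ⟨k - 1, by omega⟩
      have := hT.card_le_of_dist_heavy_le hq1 hdeg hl hleaf k c
        (fun u v h h' => (hc u v h h').trans (by omega))
      have h1 : (q + 1) * q ^ k ≤ (2 * q) * q ^ k := Nat.mul_le_mul_right _ (by omega)
      calc _ ≤ _ := this
        _ ≤ _ := h1
        _ = _ := by ring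
  · rintro ⟨k, rfl⟩
    exact hT.card_le_of_dist_heavy_le hq1 hdeg hl hleaf _ c
        (fun u v h h' => (hc u v h h').trans (by omega))

end MarkedLeaves

end SimpleGraph

/-! ### Recovering the vertices of K_n from its line graph -/

/-- A singleton would be contained in any set that it meets, so all sets are pairs. Pairwise meeting
pairs form a star or a triangle, and a triangle has no room for a fourth pair. -/
theorem Finset.exists_common_of_pairwise_inter {κ W : Type*} [DecidableEq W] {F : κ → Finset W}
    (hκ : ∃ s : Finset κ, 4 ≤ s.card) (hcard : ∀ k, (F k).card ≤ 2)
    (hinter : ∀ j k, j ≠ k → (F j ∩ F k).Nonempty) (hsub : ∀ j k, j ≠ k → ¬ F j ⊆ F k) :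
    ∃ a, ∀ k, a ∈ F k := by
  classical
  obtain ⟨s, hs⟩ := hκ
  have havoid : ∀ u : Finset κ, u.card < 4 → ∃ p, p ∉ u := by
    intro u hu
    obtain ⟨p, -, hp⟩ := Finset.exists_mem_notMem_of_card_lt_card (hu.trans_le hs)
    exact ⟨p, hp⟩
  have htwo : ∀ k a, a ∈ F k → ∃ b, b ≠ a ∧ F k = {a, b} := by
    intro k a ha
    obtain ⟨j, hj⟩ := havoid {k} (by simp)
    have hjk : k ≠ j := by simpa [eq_comm] using hj
    have h2 : (F k).card = 2 := by
      by_contra h2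
      have h1 : (F k).card ≤ 1 := by have := hcard k; omega
      obtain ⟨x, hx⟩ := hinter k j hjk
      rw [Finset.mem_inter] at hx
      refine hsub k j hjk fun y hy => ?_
      rw [Finset.card_le_one.1 h1 y hy x hx.1]
      exact hx.2
    obtain ⟨x, y, hxy, hF⟩ := Finset.card_eq_two.1 h2
    rw [hF, Finset.mem_insert, Finset.mem_singleton] at ha
    rcases ha with rfl | rfl
    · exact ⟨y, hxy.symm, hF⟩
    · exact ⟨x, hxy, by rw [hF, Finset.pair_comm]⟩
  obtain ⟨j, -⟩ := havoid ∅ (by simp)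
  obtain ⟨k, hk⟩ := havoid {j} (by simp)
  have hjk : j ≠ k := by simpa [eq_comm] using hk
  obtain ⟨a, ha⟩ := hinter j k hjk
  rw [Finset.mem_inter] at ha
  obtain ⟨b, hba, hb⟩ := htwo j a ha.1
  obtain ⟨c, hca, hc⟩ := htwo k a ha.2
  refine ⟨a, fun m => ?_⟩
  by_contra hm
  have hmj : m ≠ j := by rintro rfl; exact hm ha.1
  have hmk : m ≠ k := by rintro rfl; exact hm ha.2
  have hbm : b ∈ F m := by
    obtain ⟨x, hx⟩ := hinter m j hmj
    rw [Finset.mem_inter, hb, Finset.mem_insert, Finset.mem_singleton] at hx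
    rcases hx with ⟨hx, rfl | rfl⟩
    · exact absurd hx hm
    · exact hx
  have hcm : c ∈ F m := by
    obtain ⟨x, hx⟩ := hinter m k hmk
    rw [Finset.mem_inter, hc, Finset.mem_insert, Finset.mem_singleton] at hx
    rcases hx with ⟨hx, rfl | rfl⟩
    · exact absurd hx hm
    · exact hx
  have hbc : b ≠ c := by
    rintro rfl
    exact hsub j k hjk (by rw [hb, hc])
  obtain ⟨p, hp⟩ := havoid {j, k, m} (Finset.card_le_three.trans_lt (by norm_num))
  simp only [Finset.mem_insert, Finset.mem_singleton, not_or] at hp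
  obtain ⟨hpj, hpk, hpm⟩ := hp
  obtain ⟨d, -, hd⟩ := htwo m b hbm
  have hFm : F m = {b, c} := by
    rw [hd, Finset.mem_insert, Finset.mem_singleton] at hcm
    rcases hcm with h | h
    · exact absurd h.symm hbc
    · rw [hd, h]
  by_cases hap : a ∈ F p
  · obtain ⟨e, -, he⟩ := htwo p a hap
    obtain ⟨x, hx⟩ := hinter p m hpm
    rw [Finset.mem_inter, he, hFm] at hx
    simp only [Finset.mem_insert, Finset.mem_singleton] at hx
    have h1 : e = b ∨ e = c := by grind
    rcases h1 with rfl | rfl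
    · exact hsub p j hpj (by rw [he, hb])
    · exact hsub p k hpk (by rw [he, hc])
  · have hbp : b ∈ F p := by
      obtain ⟨x, hx⟩ := hinter p j hpj
      rw [Finset.mem_inter, hb] at hx
      simp only [Finset.mem_insert, Finset.mem_singleton] at hx
      grind
    have hcp : c ∈ F p := by
      obtain ⟨x, hx⟩ := hinter p k hpk
      rw [Finset.mem_inter, hc] at hx
      simp only [Finset.mem_insert, Finset.mem_singleton] at hx
      grind
    refine hsub m p (Ne.symm hpm) ?_
    rw [hFm]
    intro x hx
    simp only [Finset.mem_insert, Finset.mem_singleton] at hx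
    rcases hx with rfl | rfl <;> assumption

/-- A line graph of a complete graph on at least five vertices has only one root: if the edges of
the complete graph carry sets of size at most two which intersect exactly if the edges do, then
these sets come from an injection on the vertices. -/
theorem exists_injective_mem_of_inter_iff {ι W : Type*} [Fintype ι] (hι : 5 ≤ Fintype.card ι)
    (A : ι → ι → Finset W) (hsymm : ∀ i j, A i j = A j i) (hcard : ∀ i j, i ≠ j → (A i j).card ≤ 2)
    (hmeet : ∀ i j k, i ≠ j → i ≠ k → j ≠ k → ∃ x, x ∈ A i j ∧ x ∈ A i k)
    (hdisj : ∀ i j k l, i ≠ j → k ≠ l → i ≠ k → i ≠ l → j ≠ k → j ≠ l →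
      ∀ x, x ∈ A i j → x ∉ A k l) :
    ∃ f : ι → W, Function.Injective f ∧ ∀ i j, i ≠ j → f i ∈ A i j := by
  classical
  have havoid : ∀ u : Finset ι, u.card < 5 → ∃ p, p ∉ u := by
    intro u hu
    obtain ⟨p, -, hp⟩ := Finset.exists_mem_notMem_of_card_lt_card (t := Finset.univ) (s := u)
      (by rw [Finset.card_univ]; omega)
    exact ⟨p, hp⟩
  have hstar : ∀ i, ∃ a, ∀ j, i ≠ j → a ∈ A i j := by
    intro i
    obtain ⟨a, ha⟩ := Finset.exists_common_of_pairwise_inter (κ := {j // i ≠ j})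
      (F := fun j => A i j)
      ⟨Finset.univ, by rw [Finset.card_univ, Fintype.card_subtype_compl,
        Fintype.card_subtype_eq']; omega⟩
      (fun j => hcard i j j.2)
      (by
        intro j k hjk
        obtain ⟨x, hx⟩ := hmeet i j k j.2 k.2 (fun h => hjk (Subtype.ext h))
        exact ⟨x, Finset.mem_inter.2 hx⟩)
      (by
        rintro ⟨j, hj⟩ ⟨k, hk⟩ hjk hsub
        -- If `A i j ⊆ A i k`, a common element of `A j i` and `A j m` would lie in the sets of the
        -- disjoint edges ik and jm.
        have hjk : j ≠ k := fun h => hjk (Subtype.ext h)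
        obtain ⟨m, hm⟩ := havoid {i, j, k} (Finset.card_le_three.trans_lt (by norm_num))
        simp only [Finset.mem_insert, Finset.mem_singleton, not_or] at hm
        obtain ⟨hmi, hmj, hmk⟩ := hm
        obtain ⟨x, hx, hx'⟩ := hmeet j i m (Ne.symm hj) (Ne.symm hmj) (Ne.symm hmi)
        rw [hsymm j i] at hx
        exact hdisj i k j m hk (Ne.symm hmj) hj (Ne.symm hmi) (Ne.symm hjk) (Ne.symm hmk) x
          (hsub hx) hx')
    exact ⟨a, fun j hj => ha ⟨j, hj⟩⟩
  choose f hf using hstar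
  refine ⟨f, fun i j hij => ?_, hf⟩
  by_contra hne
  obtain ⟨p, hp⟩ := havoid {i, j} (Finset.card_le_two.trans_lt (by norm_num))
  obtain ⟨q, hq⟩ := havoid {i, j, p} (Finset.card_le_three.trans_lt (by norm_num))
  simp only [Finset.mem_insert, Finset.mem_singleton, not_or] at hp hq
  have h1 := hf i p (Ne.symm hp.1)
  have h2 := hf j q (Ne.symm hq.2.1)
  rw [← hij] at h2
  exact hdisj i p j q (Ne.symm hp.1) (Ne.symm hq.2.1) hne (Ne.symm hq.1) hp.2 (Ne.symm hq.2.2)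
    _ h1 h2

/-! ### The upper bound for a given representation -/

namespace SimpleGraph

variable {W : Type*} {T : SimpleGraph W}

/-- Degree counting: the degrees sum to twice the number of vertices minus 2, while each leaf falls
short of degree 2 by at least one. -/
theorem Subgraph.ncard_leaves_le_two [Finite W] (S : T.Subgraph) (hS : S.coe.IsTree)
    (hdeg : ∀ x ∈ S.verts, (S.neighborSet x).ncard ≤ 2) :
    {x | IsLeafOf S x}.ncard ≤ 2 := by
  classical
  have := Fintype.ofFinite W
  let L : Finset S.verts := {x | IsLeafOf S (x : W)}
  have hL : {x | IsLeafOf S x}.ncard = L.card := by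
    have : {x | IsLeafOf S x} = ((L.map (Function.Embedding.subtype _) : Finset W) : Set W) := by
      ext x
      simp only [L, Set.mem_ofPred_eq, Finset.coe_map, Function.Embedding.subtype_apply,
        Set.mem_image, Finset.mem_coe, Finset.mem_filter, Finset.mem_univ, true_and,
        Subtype.exists, exists_and_right, exists_eq_right]
      exact ⟨fun h => ⟨h.1, h⟩, fun h => h.2⟩
    rw [this, Set.ncard_coe_finset, Finset.card_map]
  have hsum : ∑ x : S.verts, (S.neighborSet x).ncard = 2 * S.coe.edgeFinset.card := by
    rw [← S.coe.sum_degrees_eq_twice_card_edges]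
    refine Finset.sum_congr rfl fun x _ => ?_
    rw [← Nat.card_coe_set_eq, ← card_neighborSet_eq_degree]
    convert (Nat.card_congr (S.coeNeighborSetEquiv x)).symm.trans Nat.card_eq_fintype_card
  have hE := hS.card_edgeFinset
  have hle : ∑ x : S.verts, ((S.neighborSet x).ncard + if IsLeafOf S (x : W) then 1 else 0) ≤
      ∑ _x : S.verts, 2 := by
    refine Finset.sum_le_sum fun x _ => ?_
    split_ifs with h
    · exact Nat.add_le_add_right h.2 1
    · exact hdeg x x.2
  rw [Finset.sum_add_distrib, hsum, ← Finset.card_filter, Finset.sum_const, smul_eq_mul,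
    Finset.card_univ] at hle
  rw [hL]
  change _ + L.card ≤ _ at hle
  omega

theorem IsTree.mem_verts_of_dist_add_dist (hT : T.IsTree) {S : T.Subgraph} (hS : S.coe.IsTree)
    {a c y : W} (ha : a ∈ S.verts) (hc : c ∈ S.verts)
    (h : T.dist a y + T.dist y c = T.dist a c) : y ∈ S.verts := by
  lift a to S.verts using ha
  lift c to S.verts using hc
  obtain ⟨p⟩ := hS.connected.preconnected a c
  have := hT.mem_support_of_dist_add_dist (a := S.hom a) (c := S.hom c) h (p.map S.hom)
  rw [Walk.support_map, List.mem_map] at this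
  obtain ⟨z, -, rfl⟩ := this
  exact z.2

theorem IsTree.dist_lt_ncard [Finite W] (hT : T.IsTree) {s : Set W} {v w : W}
    (h : ∀ y, T.dist v y + T.dist y w = T.dist v w → y ∈ s) : T.dist v w + 1 ≤ s.ncard := by
  classical
  obtain ⟨p, hp, hlen⟩ := hT.connected.exists_path_of_dist v w
  have hsub : ((p.support.toFinset : Finset W) : Set W) ⊆ s := by
    intro y hy
    rw [Finset.mem_coe, List.mem_toFinset] at hy
    apply h
    have h1 := T.dist_le (p.takeUntil y hy)
    have h2 := T.dist_le (p.dropUntil y hy)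
    have h3 := hT.connected.dist_triangle (u := v) (v := y) (w := w)
    have h4 := congrArg Walk.length (p.take_spec hy)
    rw [Walk.length_append] at h4
    omega
  have := Set.ncard_le_ncard hsub (Set.toFinite _)
  rwa [Set.ncard_coe_finset, List.toFinset_card_of_nodup hp.support_nodup, Walk.length_support,
    hlen] at this

/-- Two heavy edges pointing away from each other, with marked leaves `a`, `b` and `c`, `d` beyond
them: the paths from `a` to `c` and from `b` to `d` have everything between the edges in common. -/
theorem IsTree.dist_add_dist_of_between {ι : Type*} [Fintype ι] {l : ι → W} (hT : T.IsTree)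
    {u v u' v' : W} {i k : ι} (huv : T.Adj u v) (huv' : T.Adj u' v')
    (h1 : T.dist v v' = T.dist u v' + 1) (h2 : T.dist v v' = T.dist v u' + 1)
    (hi : i ∈ T.farSide l u v) (hk : k ∈ T.farSide l u' v') :
    i ≠ k ∧ ∀ y, T.dist v y + T.dist y v' = T.dist v v' →
      T.dist (l i) y + T.dist y (l k) = T.dist (l i) (l k) := by
  rw [mem_farSide] at hi hk
  have h3 := hT.dist_eq_of_separates huv hi h1
  have h4 := hT.connected.dist_triangle (u := l i) (v := v) (w := u')
  have h5 := hT.connected.dist_triangle (u := l i) (v := u') (w := v')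
  have e1 := T.dist_comm (u := l i) (v := v)
  have e2 := T.dist_comm (u := l i) (v := u')
  have e3 := T.dist_comm (u := l i) (v := v')
  have e4 := T.dist_comm (u := l k) (v := v')
  rw [dist_eq_one_iff_adj.2 huv'] at h5
  have h6 : T.dist v' (l i) = T.dist u' (l i) + 1 := by omega
  refine ⟨?_, fun y hy => ?_⟩
  · rintro rfl
    omega
  · have h7 := hT.dist_eq_of_separates huv'.symm h6 hk
    have h8 := hT.connected.dist_triangle (u := l i) (v := v) (w := y)
    have h9 := hT.connected.dist_triangle (u := y) (v := v') (w := l k)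
    have h10 := hT.connected.dist_triangle (u := l i) (v := y) (w := l k)
    have e5 := T.dist_comm (u := l i) (v := l k)
    omega

end SimpleGraph

open SimpleGraph in
theorem le_of_inORTH_lineGraph_completeGraph {n q t : ℕ} (hn : 5 ≤ n) (hq : 2 ≤ q) (ht : 3 ≤ t)
    (H : InORTH (q + 1) 2 t (⊤ : SimpleGraph (Fin n)).lineGraph) :
    (Odd t → n ≤ 2 * q ^ ((t - 1) / 2)) ∧ (Even t → n ≤ (q + 1) * q ^ (t / 2 - 1)) := by
  classical
  obtain ⟨W, hW, T, S, hS⟩ := H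
  have := Fintype.ofFinite W
  have hT := hS.isTree
  let e : ∀ i j : Fin n, i ≠ j → (⊤ : SimpleGraph (Fin n)).edgeSet :=
    fun i j hij => ⟨s(i, j), by simpa using hij⟩
  let A : Fin n → Fin n → Finset W := fun i j =>
    if hij : i ≠ j then Finset.univ.filter (fun x => IsLeaf T x ∧ x ∈ (S (e i j hij)).verts) else ∅
  have hA : ∀ i j (hij : i ≠ j) x, x ∈ A i j ↔ IsLeaf T x ∧ x ∈ (S (e i j hij)).verts := by
    intro i j hij x
    simp [A, hij]
  have hadj : ∀ i j k l (hij : i ≠ j) (hkl : k ≠ l), i ≠ k → i ≠ l → j ≠ k → j ≠ l →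
      e i j hij ≠ e k l hkl ∧
      ¬ (⊤ : SimpleGraph (Fin n)).lineGraph.Adj (e i j hij) (e k l hkl) := by
    intro i j k l hij hkl h1 h2 h3 h4
    constructor
    · simp [e, h1, h2]
    · rintro ⟨-, x, hx, hx'⟩
      simp only [e, SetLike.mem_coe, Sym2.mem_iff] at hx hx'
      grind
  have hsymm : ∀ i j (hij : i ≠ j), e i j hij = e j i hij.symm :=
    fun i j hij => Subtype.ext Sym2.eq_swap
  obtain ⟨l, hl, hmem⟩ := exists_injective_mem_of_inter_iff (by simpa using hn) A
    (by
      intro i j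
      by_cases hij : i = j
      · rw [hij]
      · ext x
        rw [hA i j hij, hA j i (Ne.symm hij), hsymm i j hij])
    (by
      intro i j hij
      refine le_trans ?_ ((S (e i j hij)).ncard_leaves_le_two (hS.subtree_isTree _)
        (hS.subtree_degree_le _))
      rw [← Set.ncard_coe_finset]
      refine Set.ncard_le_ncard ?_ (Set.toFinite _)
      intro x hx
      rw [Finset.mem_coe, hA i j hij] at hx
      -- A leaf of `T` that lies in a subtree is also a leaf of that subtree.
      exact ⟨hx.2, (Set.ncard_le_ncard ((S (e i j hij)).neighborSet_subset x)
        (Set.toFinite _)).trans hx.1⟩)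
    (by
      intro i j k hij hik hjk
      have hne : e i j hij ≠ e i k hik := by
        simp only [e, ne_eq, Subtype.mk.injEq, Sym2.eq_iff]
        grind
      have : (⊤ : SimpleGraph (Fin n)).lineGraph.Adj (e i j hij) (e i k hik) :=
        ⟨hne, i, by simp [e], by simp [e]⟩
      obtain ⟨x, hx, hx1, hx2⟩ := (hS.adj_iff_leaf _ _ hne).1 this
      exact ⟨x, (hA i j hij x).2 ⟨hx, hx1⟩, (hA i k hik x).2 ⟨hx, hx2⟩⟩)
    (by
      intro i j k l hij hkl h1 h2 h3 h4 x hx hx'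
      obtain ⟨hne, hna⟩ := hadj i j k l hij hkl h1 h2 h3 h4
      rw [hA _ _ hij] at hx
      rw [hA _ _ hkl] at hx'
      exact hna ((hS.adj_iff_leaf _ _ hne).2 ⟨x, hx.1, hx.2, hx'.2⟩))
  have hlS : ∀ i j (hij : i ≠ j), l i ∈ (S (e i j hij)).verts ∧ l j ∈ (S (e i j hij)).verts := by
    intro i j hij
    refine ⟨((hA i j hij _).1 (hmem i j hij)).2, ?_⟩
    rw [hsymm i j hij]
    exact ((hA j i hij.symm _).1 (hmem j i hij.symm)).2
  have hleaf : ∀ i, IsLeaf T (l i) := by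
    intro i
    obtain ⟨j, hj⟩ : ∃ j, i ≠ j := by
      have : Nontrivial (Fin n) := Fin.nontrivial_iff_two_le.2 (by omega)
      obtain ⟨j, hj⟩ := exists_ne i
      exact ⟨j, hj.symm⟩
    exact ((hA i j hj _).1 (hmem i j hj)).1
  have := hT.card_le_of_heavy_close (t := t) hq ht hS.degree_le hl hleaf (by
    rintro u v u' v' ⟨huv, hc⟩ ⟨huv', hc'⟩ h1 h2
    obtain ⟨i, hi, j, hj, hij⟩ := Finset.one_lt_card.1 hc
    obtain ⟨k, hk, m, hm, hkm⟩ := Finset.one_lt_card.1 hc'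
    obtain ⟨hik, hb⟩ := hT.dist_add_dist_of_between huv huv' h1 h2 hi hk
    obtain ⟨hjm, hb'⟩ := hT.dist_add_dist_of_between huv huv' h1 h2 hj hm
    obtain ⟨him, -⟩ := hT.dist_add_dist_of_between huv huv' h1 h2 hi hm
    obtain ⟨hjk, -⟩ := hT.dist_add_dist_of_between huv huv' h1 h2 hj hk
    obtain ⟨hne, hna⟩ := hadj i k j m hik hjm hij him hjk.symm hkm
    -- The edges ik and jm of K_n are disjoint, so their subtrees share fewer than `t` vertices, yet
    -- both contain the whole path from `v` to `v'`.
    rw [hS.adj_iff_card _ _ hne, not_le] at hna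
    have := hT.dist_lt_ncard (v := v) (w := v')
      (s := (S (e i k hik)).verts ∩ (S (e j m hjm)).verts) (fun y hy =>
      ⟨hT.mem_verts_of_dist_add_dist (hS.subtree_isTree _) (hlS i k hik).1 (hlS i k hik).2
        (hb y hy), hT.mem_verts_of_dist_add_dist (hS.subtree_isTree _) (hlS j m hjm).1
        (hlS j m hjm).2 (hb' y hy)⟩)
    omega)
  rwa [Fintype.card_fin] at this

/-! ### Orthodox representations by paths between marked leaves -/

namespace SimpleGraph

/-- A graph is acyclic if every vertex has at most one neighbour whose rank does not exceed its
own. -/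
theorem isAcyclic_of_rank {W : Type*} {T : SimpleGraph W} (rank : W → ℕ)
    (h : ∀ x y z, T.Adj x y → T.Adj x z → rank y ≤ rank x → rank z ≤ rank x → y = z) :
    T.IsAcyclic := by
  classical
  intro v c hc
  -- On a cycle, a vertex of maximal rank has two distinct neighbours whose rank does not exceed its
  -- own.
  obtain ⟨x, hx, hmax⟩ := c.support.toFinset.exists_max_image rank ⟨v, by simp⟩
  rw [List.mem_toFinset] at hx
  have hc' := hc.rotate hx
  have hmem : ∀ y ∈ (c.rotate x hx).support, rank y ≤ rank x := by
    intro y hy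
    apply hmax
    rw [List.mem_toFinset, ← Walk.mem_verts_toSubgraph, ← c.toSubgraph_rotate hx,
      Walk.mem_verts_toSubgraph]
    exact hy
  have hn := hc'.not_nil
  exact hc'.snd_ne_penultimate (h x _ _ (Walk.adj_snd hn) (Walk.adj_penultimate hn).symm
    (hmem _ (Walk.getVert_mem_support _ _)) (hmem _ (Walk.getVert_mem_support _ _)))

theorem Walk.mem_support_of_boundary {W : Type*} {T : SimpleGraph W} {u v x : W} (p : T.Walk u v)
    (D : Set W) (hu : u ∈ D) (hv : v ∉ D) (h : ∀ y z, T.Adj y z → y ∈ D → z ∉ D → y = x) :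
    x ∈ p.support := by
  obtain ⟨d, hd, h1, h2⟩ := p.exists_boundary_dart D hu hv
  rw [← h _ _ d.adj h1 h2]
  exact p.dart_fst_mem_support_of_mem_darts hd

theorem Walk.IsPath.ncard_neighborSet_of_ne {W : Type*} {T : SimpleGraph W} {u v x : W}
    {p : T.Walk u v} (hp : p.IsPath) (hx : x ∈ p.support) (hu : x ≠ u) (hv : x ≠ v) :
    (p.toSubgraph.neighborSet x).ncard = 2 := by
  obtain ⟨i, rfl, hi⟩ := Walk.mem_support_iff_exists_getVert.1 hx
  have h0 : i ≠ 0 := by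
    rintro rfl
    simp at hu
  have h1 : i ≠ p.length := by
    rintro rfl
    simp at hv
  exact hp.ncard_neighborSet_toSubgraph_internal_eq_two h0 (by omega)

theorem Walk.IsPath.ncard_neighborSet_le_two {W : Type*} {T : SimpleGraph W} {u v x : W}
    {p : T.Walk u v} (hp : p.IsPath) (huv : u ≠ v) (hx : x ∈ p.support) :
    (p.toSubgraph.neighborSet x).ncard ≤ 2 := by
  have hn : ¬ p.Nil := fun h => huv h.eq
  by_cases hu : x = u
  · rw [hu, hp.neighborSet_toSubgraph_startpoint hn]
    simp
  by_cases hv : x = v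
  · rw [hv, hp.neighborSet_toSubgraph_endpoint hn]
    simp
  exact (hp.ncard_neighborSet_of_ne hx hu hv).le

end SimpleGraph

open SimpleGraph

/-- The edge ij is represented by the path from `l i` to `l j`. The set `R i` is a stretch common to
all paths that start at `l i`, which forces `t` common vertices when two edges meet. -/
theorem inORTH_of_leaves {W : Type} [Finite W] {T : SimpleGraph W} (hT : T.IsTree) {h n t : ℕ}
    (hdeg : ∀ x, (T.neighborSet x).ncard ≤ h) (l : Fin n → W) (hl : Function.Injective l)
    (hleaf : ∀ i, IsLeaf T (l i)) (R : Fin n → Set W) (hR : ∀ i, t ≤ (R i).ncard)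
    (hRmem : ∀ i j, i ≠ j → ∀ p : T.Walk (l i) (l j), ∀ x ∈ R i, x ∈ p.support)
    (hdiff : ∀ i j k m, i ≠ k → i ≠ m → j ≠ k → j ≠ m →
      ∀ (p : T.Walk (l i) (l j)) (p' : T.Walk (l k) (l m)), p.IsPath → p'.IsPath →
        ({x | x ∈ p.support} ∩ {x | x ∈ p'.support}).ncard < t) :
    InORTH h 2 t (⊤ : SimpleGraph (Fin n)).lineGraph := by
  have hend : ∀ e : (⊤ : SimpleGraph (Fin n)).edgeSet, ∃ i j, i ≠ j ∧ e.1 = s(i, j) := by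
    rintro ⟨e, he⟩
    induction e with
    | _ i j => exact ⟨i, j, by simpa using he, rfl⟩
  choose a b hab heq using hend
  choose P hP using fun i j => (hT.existsUnique_path (l i) (l j)).exists
  let S : (⊤ : SimpleGraph (Fin n)).edgeSet → T.Subgraph := fun e => (P (a e) (b e)).toSubgraph
  have hmem : ∀ e x, x ∈ (S e).verts ↔ x ∈ (P (a e) (b e)).support :=
    fun e x => Walk.mem_verts_toSubgraph _
  have hlne : ∀ e, l (a e) ≠ l (b e) := fun e h => hab e (hl h)
  have hadj : ∀ e f, e ≠ f → ((⊤ : SimpleGraph (Fin n)).lineGraph.Adj e f ↔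
      ∃ i, (i = a e ∨ i = b e) ∧ (i = a f ∨ i = b f)) := by
    intro e f hef
    constructor
    · rintro ⟨-, i, hi, hi'⟩
      rw [SetLike.mem_coe, heq, Sym2.mem_iff] at hi hi'
      exact ⟨i, hi, hi'⟩
    · rintro ⟨i, hi, hi'⟩
      refine ⟨hef, i, ?_, ?_⟩ <;> rw [SetLike.mem_coe, heq, Sym2.mem_iff] <;> assumption
  have hRsub : ∀ e i, (i = a e ∨ i = b e) → R i ⊆ (S e).verts := by
    rintro e i (rfl | rfl) x hx <;> rw [hmem]
    · exact hRmem _ _ (hab e) _ x hx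
    · have := hRmem _ _ (hab e).symm (P (a e) (b e)).reverse x hx
      rwa [Walk.support_reverse, List.mem_reverse] at this
  have hlmem : ∀ e i, (i = a e ∨ i = b e) → l i ∈ (S e).verts := by
    rintro e i (rfl | rfl) <;> rw [hmem] <;> simp
  have hTleaf : ∀ e x, x ∈ (S e).verts → IsLeaf T x → x = l (a e) ∨ x = l (b e) := by
    intro e x hx hx'
    by_contra hcon
    rw [not_or] at hcon
    have h1 := (hP (a e) (b e)).ncard_neighborSet_of_ne ((hmem e x).1 hx) hcon.1 hcon.2
    have h2 := Set.ncard_le_ncard ((S e).neighborSet_subset x) (Set.toFinite _)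
    have h3 : ((S e).neighborSet x).ncard = 2 := h1
    rw [IsLeaf] at hx'
    omega
  refine ⟨W, inferInstance, T, S, ⟨⟨hT, hdeg, fun e => ⟨?_, hT.isAcyclic.subgraph _⟩, ?_, ?_⟩,
    ?_, ?_⟩⟩
  · exact ((P (a e) (b e)).toSubgraph_connected).coe
  · intro e x hx
    exact (hP _ _).ncard_neighborSet_le_two (hlne e) ((hmem e x).1 hx)
  · intro e f hef
    rw [hadj e f hef]
    constructor
    · rintro ⟨i, hi, hi'⟩
      exact (hR i).trans (Set.ncard_le_ncard
        (Set.subset_inter (hRsub e i hi) (hRsub f i hi')) (Set.toFinite _))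
    · intro h
      by_contra hcon
      push Not at hcon
      have h1 := hcon (a e) (Or.inl rfl)
      have h2 := hcon (b e) (Or.inr rfl)
      have h3 := hdiff _ _ _ _ h1.1 h1.2 h2.1 h2.2 _ _ (hP (a e) (b e)) (hP (a f) (b f))
      have h4 : (S e).verts ∩ (S f).verts = {x | x ∈ (P (a e) (b e)).support} ∩
          {x | x ∈ (P (a f) (b f)).support} := by
        simp only [S, Walk.verts_toSubgraph]
      rw [h4] at h
      omega
  · rintro e x ⟨hx, hx'⟩
    by_cases h1 : x = l (a e)
    · rw [h1]
      exact hleaf _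
    by_cases h2 : x = l (b e)
    · rw [h2]
      exact hleaf _
    have : ((S e).neighborSet x).ncard = 2 :=
      (hP (a e) (b e)).ncard_neighborSet_of_ne ((hmem e x).1 hx) h1 h2
    omega
  · intro e f hef
    rw [hadj e f hef]
    constructor
    · rintro ⟨i, hi, hi'⟩
      exact ⟨l i, hleaf i, hlmem e i hi, hlmem f i hi'⟩
    · rintro ⟨x, hx, hxe, hxf⟩
      have h1 : ∃ i, (i = a e ∨ i = b e) ∧ x = l i := by
        rcases hTleaf e x hxe hx with h | h
        · exact ⟨_, Or.inl rfl, h⟩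
        · exact ⟨_, Or.inr rfl, h⟩
      obtain ⟨i, hi, rfl⟩ := h1
      refine ⟨i, hi, ?_⟩
      rcases hTleaf f _ hxf hx with h | h
      · exact Or.inl (hl h)
      · exact Or.inr (hl h)

/-! ### The extremal trees: trees of words hung on a star -/

/-- Keep the first `m` entries of a word and replace the others by `0`. -/
def truncWord {K : ℕ} {α : Type} [Zero α] (m : ℕ) (f : Fin K → α) : Fin K → α :=
  fun j => if (j : ℕ) < m then f j else 0

section TruncWord

variable {K : ℕ} {α : Type} [Zero α]

theorem truncWord_truncWord {m m' : ℕ} (h : m ≤ m') (f : Fin K → α) :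
    truncWord m (truncWord m' f) = truncWord m f := by
  funext j
  simp only [truncWord]
  split_ifs <;> first | rfl | omega

theorem truncWord_eq_self {m : ℕ} (h : K ≤ m) (f : Fin K → α) : truncWord m f = f := by
  funext j
  simp only [truncWord]
  rw [if_pos (by omega)]

end TruncWord

/-- The vertices of a tree whose central part is a star with vertex set `H` and centre `0`: at every
`b ∈ L` starts a tree of words in `α`, which are free in the first `K` entries and constant
afterwards; a vertex consists of a level `m < D`, of `b` and of a word of length `m`. -/
abbrev StarTreeVertex (D K : ℕ) (α : Type) [Zero α] {H : Type} (L : Set H) : Type :=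
  {x : Fin D × H × (Fin K → α) // (x.2.1 ∈ L ∨ (x.1 : ℕ) = 0) ∧ truncWord x.1 x.2.2 = x.2.2}

namespace StarTreeVertex

variable {D K : ℕ} {α : Type} [Zero α] {H : Type} {L : Set H}

/-- The level of a vertex, counted from the central star. -/
def level (x : StarTreeVertex D K α L) : ℕ := x.1.1

/-- The vertex of the central star below which a vertex lies. -/
def base (x : StarTreeVertex D K α L) : H := x.1.2.1

/-- The word of a vertex, filled up with zeros. -/
def word (x : StarTreeVertex D K α L) : Fin K → α := x.1.2.2

theorem ext_of {x y : StarTreeVertex D K α L} (h1 : x.level = y.level) (h2 : x.base = y.base)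
    (h3 : x.word = y.word) : x = y :=
  Subtype.ext (Prod.ext (Fin.ext h1) (Prod.ext h2 h3))

theorem level_lt (x : StarTreeVertex D K α L) : x.level < D := x.1.1.2

theorem truncWord_level (x : StarTreeVertex D K α L) : truncWord x.level x.word = x.word := x.2.2

theorem base_mem (x : StarTreeVertex D K α L) (h : x.level ≠ 0) : x.base ∈ L :=
  x.2.1.resolve_right h

/-- The vertex at level `m` with base `b` whose word is a prefix of `f`. -/
def ofWord {b : H} (hb : b ∈ L) (f : Fin K → α) (m : ℕ) (hm : m < D) : StarTreeVertex D K α L :=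
  ⟨(⟨m, hm⟩, b, truncWord m f), Or.inl hb, truncWord_truncWord le_rfl f⟩

/-- The vertices of the central star. -/
def root (hD : 0 < D) (b : H) : StarTreeVertex D K α L :=
  ⟨(⟨0, hD⟩, b, 0), Or.inr rfl, by funext j; simp [truncWord]⟩

@[simp] theorem level_ofWord {b : H} (hb : b ∈ L) (f : Fin K → α) (m : ℕ) (hm : m < D) :
    (ofWord hb f m hm).level = m := rfl

@[simp] theorem base_ofWord {b : H} (hb : b ∈ L) (f : Fin K → α) (m : ℕ) (hm : m < D) :
    (ofWord hb f m hm).base = b := rfl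

@[simp] theorem word_ofWord {b : H} (hb : b ∈ L) (f : Fin K → α) (m : ℕ) (hm : m < D) :
    (ofWord hb f m hm).word = truncWord m f := rfl

@[simp] theorem level_root (hD : 0 < D) (b : H) :
    (root hD b : StarTreeVertex D K α L).level = 0 := rfl

@[simp] theorem base_root (hD : 0 < D) (b : H) :
    (root hD b : StarTreeVertex D K α L).base = b := rfl

theorem eq_root (hD : 0 < D) {x : StarTreeVertex D K α L} (h : x.level = 0) :
    x = root hD x.base := by
  refine ext_of h rfl ?_
  rw [← x.truncWord_level, h]
  funext j
  simp [truncWord, root, word]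

theorem ofWord_zero {b : H} (hb : b ∈ L) (f : Fin K → α) (hD : 0 < D) :
    ofWord hb f 0 hD = root hD b :=
  eq_root hD rfl

theorem eq_ofWord {x : StarTreeVertex D K α L} (h : x.base ∈ L) :
    x = ofWord h x.word x.level x.level_lt :=
  ext_of rfl rfl x.truncWord_level.symm

/-- The children of a vertex outside the central star. -/
def children (x : StarTreeVertex D K α L) : Set (StarTreeVertex D K α L) :=
  {y | x.level + 1 = y.level ∧ x.base = y.base ∧ truncWord x.level y.word = x.word}

theorem ncard_children_le [Finite α] (x : StarTreeVertex D K α L) :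
    x.children.ncard ≤ Nat.card α := by
  classical
  rw [← Set.ncard_univ]
  refine Set.ncard_le_ncard_of_injOn
    -- A child is determined by its new letter; from level `K` on there is no new letter and at most
    -- one child.
    (fun y => if h : x.level < K then y.word ⟨x.level, h⟩ else 0) (fun _ _ => Set.mem_univ _) ?_
    (Set.toFinite _)
  rintro y ⟨h1, h2, h3⟩ z ⟨h1', h2', h3'⟩ hyz
  refine ext_of (h1.symm.trans h1') (h2.symm.trans h2') ?_
  funext j
  rcases lt_trichotomy (j : ℕ) x.level with hj | hj | hj
  · have := congrFun (h3.trans h3'.symm) j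
    simpa [truncWord, hj] using this
  · have hK : x.level < K := hj ▸ j.2
    obtain rfl : j = ⟨x.level, hK⟩ := Fin.ext hj
    simpa [hK] using hyz
  · have hy := congrFun y.truncWord_level j
    have hz := congrFun z.truncWord_level j
    rw [← hy, ← hz]
    simp only [truncWord]
    rw [if_neg (by omega), if_neg (by omega)]

variable [Zero H]

/-- `y` is the parent of `x`. -/
def IsParent (x y : StarTreeVertex D K α L) : Prop :=
  (y.level + 1 = x.level ∧ y.base = x.base ∧ truncWord y.level x.word = y.word) ∨
    (x.level = 0 ∧ y.level = 0 ∧ x.base ≠ 0 ∧ y.base = 0)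

theorem IsParent.unique {x y z : StarTreeVertex D K α L} (hy : x.IsParent y) (hz : x.IsParent z) :
    y = z := by
  rcases hy with ⟨h1, h2, h3⟩ | ⟨h1, h2, h3, h4⟩ <;>
    rcases hz with ⟨h1', h2', h3'⟩ | ⟨h1', h2', h3', h4'⟩
  · have h : y.level = z.level := by omega
    exact ext_of h (h2.trans h2'.symm) (by rw [← h3, ← h3', h])
  · omega
  · omega
  · have hD : 0 < D := by have := x.level_lt; omega
    rw [eq_root hD h2, eq_root hD h2', h4, h4']

open Classical in
/-- A rank which decreases from a vertex to its parent. -/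
noncomputable def rank (x : StarTreeVertex D K α L) : ℕ :=
  2 * x.level + if x.base = 0 then 0 else 1

theorem IsParent.rank_lt {x y : StarTreeVertex D K α L} (h : x.IsParent y) : y.rank < x.rank := by
  rcases h with ⟨h1, h2, h3⟩ | ⟨h1, h2, h3, h4⟩
  · simp only [rank]
    split_ifs <;> omega
  · simp [rank, h1, h2, h3, h4]

variable (D K α L) in
/-- The tree on `StarTreeVertex D K α L`. -/
def starTree : SimpleGraph (StarTreeVertex D K α L) where
  Adj x y := x.IsParent y ∨ y.IsParent x
  symm := ⟨fun _ _ h => h.symm⟩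
  loopless := ⟨fun _ h => h.elim (fun h => h.rank_lt.false) fun h => h.rank_lt.false⟩

theorem starTree_isAcyclic : (starTree D K α L).IsAcyclic := by
  refine SimpleGraph.isAcyclic_of_rank rank ?_
  rintro x y z (hy | hy) (hz | hz) h1 h2
  · exact hy.unique hz
  · exact absurd hz.rank_lt h2.not_gt
  · exact absurd hy.rank_lt h1.not_gt
  · exact absurd hy.rank_lt h1.not_gt

theorem exists_walk_ofWord_root {b : H} (hb : b ∈ L) (f : Fin K → α) (hD : 0 < D) (m : ℕ)
    (hm : m < D) : ∃ p : (starTree D K α L).Walk (ofWord hb f m hm) (root hD b),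
      ∀ y ∈ p.support, ∃ m' hm', y = ofWord hb f m' hm' := by
  induction m with
  | zero =>
    refine ⟨SimpleGraph.Walk.nil.copy rfl (ofWord_zero hb f hD), ?_⟩
    intro y hy
    rw [SimpleGraph.Walk.support_copy, SimpleGraph.Walk.support_nil, List.mem_singleton] at hy
    exact ⟨_, _, hy⟩
  | succ m ih =>
    obtain ⟨p, hp⟩ := ih (by omega)
    have hadj : (starTree D K α L).Adj (ofWord hb f (m + 1) hm) (ofWord hb f m (by omega)) :=
      Or.inl (Or.inl ⟨rfl, rfl, truncWord_truncWord (by simp) f⟩)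
    refine ⟨SimpleGraph.Walk.cons hadj p, ?_⟩
    intro y hy
    rw [SimpleGraph.Walk.support_cons, List.mem_cons] at hy
    rcases hy with rfl | hy
    · exact ⟨_, _, rfl⟩
    · exact hp y hy

theorem exists_walk_root_root (hD : 0 < D) (b b' : H) :
    ∃ p : (starTree D K α L).Walk (root hD b) (root hD b'),
      ∀ y ∈ p.support, y = root hD b ∨ y = root hD b' ∨ (y = root hD 0 ∧ b ≠ b') := by
  by_cases hbb : b = b'
  · subst hbb
    exact ⟨SimpleGraph.Walk.nil, by simp⟩
  have hadj : ∀ c : H, c ≠ 0 → (starTree D K α L).Adj (root hD c) (root hD 0) :=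
    fun c hc => Or.inl (Or.inr ⟨rfl, rfl, hc, rfl⟩)
  by_cases hb : b = 0
  · subst hb
    refine ⟨SimpleGraph.Walk.cons (hadj b' (Ne.symm hbb)).symm SimpleGraph.Walk.nil, ?_⟩
    intro y hy
    simp only [SimpleGraph.Walk.support_cons, SimpleGraph.Walk.support_nil, List.mem_cons,
      List.not_mem_nil, or_false] at hy
    tauto
  by_cases hb' : b' = 0
  · subst hb'
    refine ⟨SimpleGraph.Walk.cons (hadj b hb) SimpleGraph.Walk.nil, ?_⟩
    intro y hy
    simp only [SimpleGraph.Walk.support_cons, SimpleGraph.Walk.support_nil, List.mem_cons,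
      List.not_mem_nil, or_false] at hy
    tauto
  · refine ⟨SimpleGraph.Walk.cons (hadj b hb)
      (SimpleGraph.Walk.cons (hadj b' hb').symm SimpleGraph.Walk.nil), ?_⟩
    intro y hy
    simp only [SimpleGraph.Walk.support_cons, SimpleGraph.Walk.support_nil, List.mem_cons,
      List.not_mem_nil, or_false] at hy
    tauto

theorem starTree_isTree (hD : 0 < D) : (starTree D K α L).IsTree := by
  have hreach : ∀ x : StarTreeVertex D K α L, (starTree D K α L).Reachable x (root hD 0) := by
    intro x
    have h2 : (starTree D K α L).Reachable (root hD x.base) (root hD 0) :=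
      ⟨(exists_walk_root_root hD x.base 0).choose⟩
    by_cases h : x.level = 0
    · rwa [← eq_root hD h] at h2
    · have hb := x.base_mem h
      have h1 := (exists_walk_ofWord_root hb x.word hD x.level x.level_lt).choose
      rw [← eq_ofWord hb] at h1
      exact SimpleGraph.Reachable.trans ⟨h1⟩ h2
  have : Nonempty (StarTreeVertex D K α L) := ⟨root hD 0⟩
  exact ⟨⟨fun x y => (hreach x).trans (hreach y).symm⟩, starTree_isAcyclic⟩

theorem neighborSet_subset_of_ne_root {x : StarTreeVertex D K α L}
    (hx : x.level ≠ 0 ∨ x.base ≠ 0) :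
    (starTree D K α L).neighborSet x ⊆ {y | x.IsParent y} ∪ x.children := by
  rintro y (hy | ⟨h1, h2, h3⟩ | ⟨h1, h2, h3, h4⟩)
  · exact Or.inl hy
  · exact Or.inr ⟨h1, h2, h3⟩
  · tauto

/-- The vertices at level at least `m` over `b` whose words agree with `f` in the first `m` places
can be left only through the one at level `m`. -/
theorem ofWord_mem_support {b : H} (hb : b ∈ L) (f : Fin K → α) {m m' : ℕ} (hm : m < D)
    (hm' : m' < D) (hmm : m ≤ m') {v : StarTreeVertex D K α L}
    (hv : v.base = b → truncWord m v.word ≠ truncWord m f)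
    (p : (starTree D K α L).Walk (ofWord hb f m' hm') v) : ofWord hb f m hm ∈ p.support := by
  refine p.mem_support_of_boundary
    {y | m ≤ y.level ∧ y.base = b ∧ truncWord m y.word = truncWord m f} ?_ ?_ ?_
  · exact ⟨hmm, rfl, truncWord_truncWord hmm f⟩
  · rintro ⟨-, h1, h2⟩
    exact hv h1 h2
  · rintro y z hyz ⟨h1, h2, h3⟩ hz
    have hlev : y.level = m := by
      by_contra hne
      rcases hyz with (⟨h4, h5, h6⟩ | ⟨h4, h5, h6, h7⟩) | ⟨h4, h5, h6⟩ | ⟨h4, h5, h6, h7⟩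
      · refine hz ⟨by omega, h5.trans h2, ?_⟩
        rw [← h6, truncWord_truncWord (by omega), h3]
      · omega
      · refine hz ⟨by omega, h5.symm.trans h2, ?_⟩
        rw [← h3, ← h6, truncWord_truncWord h1]
      · omega
    exact ext_of hlev h2 (by rw [← y.truncWord_level, hlev, h3]; rfl)

theorem eq_of_mem_path {b b' : H} (hb : b ∈ L) (hb' : b' ∈ L) (f f' : Fin K → α) (hD : 0 < D)
    {m m' : ℕ} (hm : m < D) (hm' : m' < D)
    {p : (starTree D K α L).Walk (ofWord hb f m hm) (ofWord hb' f' m' hm')} (hp : p.IsPath)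
    {y : StarTreeVertex D K α L} (hy : y ∈ p.support) :
    (∃ k hk, y = ofWord hb f k hk) ∨ (∃ k hk, y = ofWord hb' f' k hk) ∨ (y = root hD 0 ∧ b ≠ b') := by
  classical
  obtain ⟨p₁, h₁⟩ := exists_walk_ofWord_root hb f hD m hm
  obtain ⟨p₂, h₂⟩ := exists_walk_root_root (K := K) (α := α) (L := L) hD b b'
  obtain ⟨p₃, h₃⟩ := exists_walk_ofWord_root hb' f' hD m' hm'
  have huniq := (starTree_isAcyclic.subsingleton_path _ _).elim
    ⟨p, hp⟩ ⟨_, (p₁.append (p₂.append p₃.reverse)).bypass_isPath⟩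
  rw [show p = _ from congrArg Subtype.val huniq] at hy
  have hy := SimpleGraph.Walk.support_bypass_subset_support _ hy
  rw [SimpleGraph.Walk.mem_support_append_iff, SimpleGraph.Walk.mem_support_append_iff,
    SimpleGraph.Walk.support_reverse, List.mem_reverse] at hy
  rcases hy with hy | hy | hy
  · exact Or.inl (h₁ y hy)
  · rcases h₂ y hy with h | h | h
    · exact Or.inl ⟨0, hD, by rw [h, ofWord_zero]⟩
    · exact Or.inr (Or.inl ⟨0, hD, by rw [h, ofWord_zero]⟩)
    · exact Or.inr (Or.inr h)
  · exact Or.inr (Or.inl (h₃ y hy))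

variable [Finite α] [Finite H]

theorem ncard_setOf_isParent_le (x : StarTreeVertex D K α L) : {y | x.IsParent y}.ncard ≤ 1 :=
  (Set.ncard_le_one (Set.toFinite _)).2 fun _ ha _ hb => ha.unique hb

/-- The centre `0` is the critical vertex: it has either no children and at most q + 1 neighbours in
the star, or at most q children and one such neighbour. This is why `0 ∈ L` is allowed only for a
star with at most two vertices. -/
theorem ncard_neighborSet_le (x : StarTreeVertex D K α L)
    (hH : Nat.card H ≤ Nat.card α + 2) (hH' : (0 : H) ∈ L → Nat.card H ≤ 2) :
    ((starTree D K α L).neighborSet x).ncard ≤ Nat.card α + 1 := by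
  by_cases hx : x.level ≠ 0 ∨ x.base ≠ 0
  · have h1 := Set.ncard_le_ncard (neighborSet_subset_of_ne_root hx) (Set.toFinite _)
    have h2 := Set.ncard_union_le {y | x.IsParent y} x.children
    have h3 := x.ncard_children_le
    have h4 := x.ncard_setOf_isParent_le
    omega
  push Not at hx
  obtain ⟨hx0, hxb⟩ := hx
  have hD : 0 < D := by have := x.level_lt; omega
  have hsub : (starTree D K α L).neighborSet x ⊆ x.children ∪ root hD '' {b | b ≠ 0} := by
    rintro y ((⟨h1, h2, h3⟩ | ⟨h1, h2, h3, h4⟩) | ⟨h1, h2, h3⟩ | ⟨h1, h2, h3, h4⟩)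
    · omega
    · exact absurd hxb h3
    · exact Or.inl ⟨h1, h2, h3⟩
    · exact Or.inr ⟨y.base, h3, (eq_root hD h1).symm⟩
  have h1 := Set.ncard_le_ncard hsub (Set.toFinite _)
  have h2 := Set.ncard_union_le x.children (root hD '' {b | b ≠ 0})
  have h3 : (root hD '' {b | b ≠ 0} : Set (StarTreeVertex D K α L)).ncard ≤ Nat.card H - 1 := by
    refine (Set.ncard_image_le (Set.toFinite _)).trans ?_
    have : ({b | b ≠ 0} : Set H) = Set.univ \ {0} := by
      ext
      simp
    rw [this, Set.ncard_sdiff_singleton_of_mem (Set.mem_univ _), Set.ncard_univ]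
  by_cases h0 : (0 : H) ∈ L
  · have := hH' h0
    have := x.ncard_children_le
    omega
  · have : x.children = ∅ := by
      ext y
      simp only [children, Set.mem_ofPred_eq, Set.mem_empty_iff_false, iff_false]
      rintro ⟨h4, h5, -⟩
      apply h0
      rw [← hxb, h5]
      exact y.base_mem (by omega)
    rw [this, Set.empty_union] at h1
    omega

theorem isLeaf_of_level {x : StarTreeVertex D K α L} (h0 : x.level ≠ 0) (hx : x.level + 1 = D) :
    IsLeaf (starTree D K α L) x := by
  refine (Set.ncard_le_ncard ?_ (Set.toFinite _)).trans x.ncard_setOf_isParent_le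
  intro y hy
  refine (neighborSet_subset_of_ne_root (Or.inl h0) hy).resolve_right ?_
  rintro ⟨h1, -⟩
  have := y.level_lt
  omega

end StarTreeVertex

-- Leaves are pairs of a base and a full word, which gives `L.ncard * q ^ K` of them. In `hcount`,
-- the two ends of a path contribute `K` possible common vertices each; the centre costs one more
-- unless it is itself one of the two bases.
open StarTreeVertex in
theorem inORTH_lineGraph_of_star {H α : Type} [Zero H] [Zero α] [Finite H] [Finite α] (L : Set H)
    {n K t q : ℕ} (hα : Nat.card α = q) (ht : 1 ≤ t) (hK : 1 ≤ K)
    (hH : Nat.card H ≤ q + 2) (hH' : (0 : H) ∈ L → Nat.card H ≤ 2)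
    (hcount : 2 * K + 2 ≤ t ∨
      2 * K + 1 ≤ t ∧ ∀ b ∈ L, ∀ b' ∈ L, b ≠ b' → b = 0 ∨ b' = 0)
    (hn : n ≤ L.ncard * q ^ K) :
    InORTH (q + 1) 2 t (⊤ : SimpleGraph (Fin n)).lineGraph := by
  classical
  have hD : 0 < K + t := by omega
  have hcard : n ≤ Nat.card (L × (Fin K → α)) := by
    rwa [Nat.card_prod, Nat.card_coe_set_eq, Nat.card_fun, hα, Nat.card_eq_fintype_card,
      Fintype.card_fin]
  obtain ⟨g⟩ : Nonempty (Fin n ↪ L × (Fin K → α)) := by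
    have := Fintype.ofFinite (L × (Fin K → α))
    rw [Nat.card_eq_fintype_card] at hcard
    exact Function.Embedding.nonempty_of_card_le (by rwa [Fintype.card_fin])
  let l : Fin n → StarTreeVertex (K + t) K α L :=
    fun i => ofWord (g i).1.2 (g i).2 (K + t - 1) (by omega)
  have hg : ∀ i j, (g i).1.1 = (g j).1.1 → (g i).2 = (g j).2 → i = j :=
    fun i j h1 h2 => g.injective (Prod.ext (Subtype.ext h1) h2)
  have hne : ∀ i j k m hk hm, i ≠ j → K ≤ k →
      (ofWord (g i).1.2 (g i).2 k hk : StarTreeVertex (K + t) K α L) ≠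
        ofWord (g j).1.2 (g j).2 m hm := by
    intro i j k m hk hm hij hKk h
    obtain rfl : k = m := congrArg level h
    have h2 := congrArg word h
    rw [word_ofWord, word_ofWord, truncWord_eq_self hKk, truncWord_eq_self hKk] at h2
    exact hij (hg i j (congrArg base h) h2)
  refine inORTH_of_leaves (starTree_isTree (K := K) (α := α) (L := L) hD)
    (hα ▸ fun x => x.ncard_neighborSet_le (by omega) hH') l ?_ ?_
    -- The `t` levels from `K` to `K + t - 1`, where the word is complete and so determines the
    -- leaf.
    (fun i => (fun k : Fin t => ofWord (g i).1.2 (g i).2 (K + k) (by omega)) '' Set.univ) ?_ ?_ ?_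
  · intro i j hij
    by_contra hcon
    exact hne i j _ _ _ _ hcon (by omega) hij
  · intro i
    refine isLeaf_of_level ?_ ?_ <;> simp only [l, level_ofWord] <;> omega
  · intro i
    rw [Set.ncard_image_of_injective, Set.ncard_univ, Nat.card_eq_fintype_card, Fintype.card_fin]
    intro k m hkm
    have := congrArg level hkm
    simp only [level_ofWord] at this
    exact Fin.ext (by omega)
  · rintro i j hij p _ ⟨k, -, rfl⟩
    refine ofWord_mem_support _ _ _ _ (by omega) ?_ p
    intro h1 h2
    simp only [l, word_ofWord] at h2
    rw [truncWord_truncWord (by omega), truncWord_eq_self (by omega),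
      truncWord_eq_self (by omega)] at h2
    exact hij (hg i j h1.symm h2.symm)
  · intro i j k m hik him hjk hjm p p' hp hp'
    let U : Fin n → Set (StarTreeVertex (K + t) K α L) :=
      fun i => (fun k : Fin K => ofWord (g i).1.2 (g i).2 k (by omega)) '' Set.univ
    have hU : ∀ i, (U i).ncard ≤ K := by
      intro i
      refine (Set.ncard_image_le (Set.toFinite _)).trans ?_
      rw [Set.ncard_univ, Nat.card_eq_fintype_card, Fintype.card_fin]
    have hlow : ∀ i k hk, k < K → ofWord (g i).1.2 (g i).2 k hk ∈ U i :=
      fun i k _ h => ⟨⟨k, h⟩, trivial, rfl⟩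
    -- A vertex on `p'` below which a leaf other than its two ends lies must be at a level where
    -- words are still incomplete.
    have hlevel : ∀ y, y ∈ p'.support → ∀ a c hc, a ≠ k → a ≠ m →
        y = ofWord (g a).1.2 (g a).2 c hc → c < K := by
      rintro y hy a c hc hak ham rfl
      by_contra hcon
      rw [not_lt] at hcon
      rcases eq_of_mem_path _ _ _ _ hD _ _ hp' hy with ⟨c', hc', h⟩ | ⟨c', hc', h⟩ | ⟨h, -⟩
      · exact hne a k _ _ _ _ hak hcon h
      · exact hne a m _ _ _ _ ham hcon h
      · have := congrArg level h
        simp only [level_ofWord, level_root] at this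
        omega
    have hmem : ∀ y, y ∈ p.support → y ∈ p'.support →
        y ∈ U i ∪ U j ∨ (y = root hD 0 ∧ (g i).1.1 ≠ (g j).1.1) := by
      intro y hy hy'
      rcases eq_of_mem_path _ _ _ _ hD _ _ hp hy with ⟨c, hc, h⟩ | ⟨c, hc, h⟩ | h
      · left; left
        rw [h]
        exact hlow i c hc (hlevel y hy' i c hc hik him h)
      · left; right
        rw [h]
        exact hlow j c hc (hlevel y hy' j c hc hjk hjm h)
      · exact Or.inr h
    have hUU := Set.ncard_union_le (U i) (U j)
    have hi := hU i
    have hj := hU j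
    rcases hcount with hc | ⟨hc, hL⟩
    · have hsub : {x | x ∈ p.support} ∩ {x | x ∈ p'.support} ⊆ insert (root hD 0) (U i ∪ U j) := by
        rintro y ⟨hy, hy'⟩
        rcases hmem y hy hy' with h | ⟨h, -⟩
        · exact Or.inr h
        · exact Or.inl h
      have h1 := Set.ncard_le_ncard hsub (Set.toFinite _)
      have h2 := Set.ncard_insert_le (root hD 0) (U i ∪ U j)
      omega
    · have hsub : {x | x ∈ p.support} ∩ {x | x ∈ p'.support} ⊆ U i ∪ U j := by
        rintro y ⟨hy, hy'⟩
        rcases hmem y hy hy' with h | ⟨h, hb⟩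
        · exact h
        · rcases hL _ (g i).1.2 _ (g j).1.2 hb with h0 | h0
          · left
            rw [h, ← h0, ← ofWord_zero (g i).1.2 (g i).2 hD]
            exact hlow i 0 hD hK
          · right
            rw [h, ← h0, ← ofWord_zero (g j).1.2 (g j).2 hD]
            exact hlow j 0 hD hK
      have h1 := Set.ncard_le_ncard hsub (Set.toFinite _)
      omega

/-! ### The exact threshold -/

/-- The largest `n` such that the line graph of the complete graph on `n` vertices has an orthodox
`(q + 1, 2, t)`-representation. -/
def maxOrthOrder (q t : ℕ) : ℕ :=
  if Odd t then 2 * q ^ ((t - 1) / 2) else (q + 1) * q ^ (t / 2 - 1)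

theorem inORTH_of_le {q t n : ℕ} (hq : 2 ≤ q) (ht : 3 ≤ t) (hn : n ≤ maxOrthOrder q t) :
    InORTH (q + 1) 2 t (⊤ : SimpleGraph (Fin n)).lineGraph := by
  have : NeZero q := ⟨by omega⟩
  have hα : Nat.card (Fin q) = q := by simp
  rw [maxOrthOrder] at hn
  split_ifs at hn with hodd
  · obtain ⟨k, rfl⟩ := hodd
    -- A single edge with word trees at both ends, so the centre is itself a base.
    refine inORTH_lineGraph_of_star (H := Fin 2) (α := Fin q) (K := k) Set.univ hα (by omega)
      (by omega) (by simp) (by simp) (Or.inr ⟨le_rfl, by decide⟩) ?_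
    rwa [Set.ncard_univ, Nat.card_eq_fintype_card, Fintype.card_fin,
      show k = (2 * k + 1 - 1) / 2 by omega]
  · rw [Nat.not_odd_iff_even] at hodd
    obtain ⟨k, rfl⟩ := hodd
    -- A star with `q + 1` outer vertices; the centre carries no word tree and counts as the extra
    -- common vertex, so the depth is one less than t/2.
    refine inORTH_lineGraph_of_star (H := Fin (q + 2)) (α := Fin q) (K := k - 1) {b | b ≠ 0} hα
      (by omega) (by omega) (by simp) (by simp) (Or.inl (by omega)) ?_
    have : ({b | b ≠ 0} : Set (Fin (q + 2))) = Set.univ \ {0} := by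
      ext
      simp
    rw [this, Set.ncard_sdiff_singleton_of_mem (Set.mem_univ _), Set.ncard_univ,
      Nat.card_eq_fintype_card, Fintype.card_fin]
    rwa [show (k + k) / 2 = k by omega] at hn

theorem four_le_maxOrthOrder {q t : ℕ} (hq : 2 ≤ q) (ht : 3 ≤ t) : 4 ≤ maxOrthOrder q t := by
  have hpow : ∀ k, 1 ≤ k → 2 ≤ q ^ k := fun k hk => hq.trans (Nat.le_self_pow (by omega) q)
  rw [maxOrthOrder]
  split_ifs with hodd
  · have := hpow ((t - 1) / 2) (by omega)
    omega
  · rw [Nat.not_odd_iff_even] at hodd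
    obtain ⟨k, rfl⟩ := hodd
    have := Nat.mul_le_mul (show 3 ≤ q + 1 by omega) (hpow ((k + k) / 2 - 1) (by omega))
    omega

theorem inORTH_lineGraph_completeGraph_iff {q t n : ℕ} (hq : 2 ≤ q) (ht : 3 ≤ t) :
    InORTH (q + 1) 2 t (⊤ : SimpleGraph (Fin n)).lineGraph ↔ n ≤ maxOrthOrder q t := by
  refine ⟨fun H => ?_, inORTH_of_le hq ht⟩
  by_cases hn : 5 ≤ n
  · obtain ⟨h1, h2⟩ := le_of_inORTH_lineGraph_completeGraph hn hq ht H
    rw [maxOrthOrder]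
    split_ifs with hodd
    · exact h1 hodd
    · exact h2 (Nat.not_odd_iff_even.1 hodd)
  -- Recovering marked leaves needs five vertices, but smaller `n` never exceed the threshold.
  · have := four_le_maxOrthOrder hq ht
    omega

theorem maxOrthOrder_lt {q t : ℕ} (hq : 2 ≤ q) (ht : 3 ≤ t) :
    maxOrthOrder q t < maxOrthOrder (q + 1) t := by
  rw [maxOrthOrder, maxOrthOrder]
  split_ifs with hodd
  · have : q ^ ((t - 1) / 2) < (q + 1) ^ ((t - 1) / 2) :=
      Nat.pow_lt_pow_left (by omega) (by omega)
    omega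
  · have h1 : q ^ (t / 2 - 1) ≤ (q + 1) ^ (t / 2 - 1) := Nat.pow_le_pow_left (by omega) _
    have h2 : 0 < (q + 1) ^ (t / 2 - 1) := by positivity
    nlinarith

theorem theorem4 (h t : ℕ) (hh : 3 ≤ h) (ht : 3 ≤ t) :
    (Odd t →
      {n : ℕ | InORTH (h + 1) 2 t (⊤ : SimpleGraph (Fin n)).lineGraph ∧
          ¬ InORTH h 2 t (⊤ : SimpleGraph (Fin n)).lineGraph} =
        Set.Icc (2 * (h - 1) ^ ((t - 1) / 2) + 1) (2 * h ^ ((t - 1) / 2))) ∧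
    (Even t →
      {n : ℕ | InORTH (h + 1) 2 t (⊤ : SimpleGraph (Fin n)).lineGraph ∧
          ¬ InORTH h 2 t (⊤ : SimpleGraph (Fin n)).lineGraph} =
        Set.Icc (h * (h - 1) ^ (t / 2 - 1) + 1) ((h + 1) * h ^ (t / 2 - 1))) ∧
    (∃ n : ℕ, InORTH (h + 1) 2 t (⊤ : SimpleGraph (Fin n)).lineGraph ∧
      ¬ InORTH h 2 t (⊤ : SimpleGraph (Fin n)).lineGraph) := by
  obtain ⟨q, rfl⟩ : ∃ q, h = q + 1 := ⟨h - 1, by omega⟩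
  have hq : 2 ≤ q := by omega
  simp only [inORTH_lineGraph_completeGraph_iff hq ht,
    inORTH_lineGraph_completeGraph_iff (show 2 ≤ q + 1 by omega) ht, not_le]
  refine ⟨fun hodd => ?_, fun heven => ?_, maxOrthOrder (q + 1) t, le_rfl, maxOrthOrder_lt hq ht⟩
  · ext n
    simp only [maxOrthOrder, if_pos hodd, Set.mem_ofPred_eq, Set.mem_Icc, Nat.add_sub_cancel]
    omega
  · ext n
    simp only [maxOrthOrder, if_neg (Nat.not_odd_iff_even.2 heven), Set.mem_ofPred_eq, Set.mem_Icc,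
      Nat.add_sub_cancel]
    omega
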